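/- Let $\mathbb P=\{1,2,3,\dots\}$. Two words over $\mathbb P$ are Knuth-equivalent, written $v\equiv w$, if one can be transformed into the other by finitely many replacements (in either direction) $xacby\leftrightarrow xcaby$ with $a\le b<c$, or $xbacy\leftrightarrow xbcay$ with $a<b\le c$, where $x,y$ are words and $a,b,c\in\mathbb P$. For a word $u$ and integers $n,m\ge 0$ let $c_{n,m}(u)$ be the number of words $w$ of length $n$ with all letters at most $m$ such that $uw\equiv wu$. For every fixed $n$, the following hold. (a) If $n\ge 1$, then there is a polynomial with rational coefficients, of degree $n-1$ and with leading coefficient $1/(n-1)!$, whose value at $m$ is $c_{n,m}(1)$ for all integers $m\ge n$. (b) If $n\ge 2$, then there is a polynomial with rational coefficients, of degree $n-2$, whose value at $m$ is $c_{n,m}(12)$ for all integers $m\ge n$. Its leading coefficient is $1/(n-2)!$ if $n>2$; if $n=2$ it is the constant $2$. (c) If $n\ge k\ge 1$, then there is a polynomial with rational coefficients, of degree $n-k$, whose value at $m$ is $c_{n,m}(k(k-1)\cdots 1)$ for all integers $m\ge n$. Its leading coefficient is $1/(n-k)!$ if $n>k$; if $n=k$ it is the constant $k^k$. -/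

import Mathlib

open Polynomial
open scoped Nat

namespace KnuthCentralizer

/-- An elementary Knuth transposition on words over the positive integers:
`x a c b y ↔ x c a b y` with `a ≤ b < c`, or `x b a c y ↔ x b c a y` with `a < b ≤ c`.
The relation is oriented here; it is symmetrized in `KnuthEquiv`. -/
inductive KnuthStep : List ℕ+ → List ℕ+ → Prop
  | acb_cab (x y : List ℕ+) (a b c : ℕ+) (hab : a ≤ b) (hbc : b < c) :
      KnuthStep (x ++ [a, c, b] ++ y) (x ++ [c, a, b] ++ y)
  | bac_bca (x y : List ℕ+) (a b c : ℕ+) (hab : a < b) (hbc : b ≤ c) :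
      KnuthStep (x ++ [b, a, c] ++ y) (x ++ [b, c, a] ++ y)

/-- Knuth equivalence: the equivalence relation generated by Knuth transpositions. -/
def KnuthEquiv (v w : List ℕ+) : Prop :=
  Relation.EqvGen KnuthStep v w

/-- The centralizer `C(u)` of the word `u` in the plactic monoid, as a set of words. -/
def centralizer (u : List ℕ+) : Set (List ℕ+) :=
  {w | KnuthEquiv (u ++ w) (w ++ u)}

/-- The words in `C(u)` of length `n` all of whose letters are at most `m`. -/
def centralizerWords (n m : ℕ) (u : List ℕ+) : Set (List ℕ+) :=
  {w | w ∈ centralizer u ∧ w.length = n ∧ ∀ a ∈ w, (a : ℕ) ≤ m}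

/-- There are finitely many such words, so that their `Set.ncard` is the true count. -/
theorem centralizerWords_finite (n m : ℕ) (u : List ℕ+) : (centralizerWords n m u).Finite := by
  have hS : {a : ℕ+ | (a : ℕ) ≤ m}.Finite :=
    Set.Finite.of_finite_image ((Set.finite_Iic m).subset (by rintro _ ⟨a, ha, rfl⟩; exact ha))
      PNat.coe_injective.injOn
  have : Finite {a : ℕ+ | (a : ℕ) ≤ m} := hS
  refine ((List.finite_length_eq {a : ℕ+ | (a : ℕ) ≤ m} n).image
    (List.map Subtype.val)).subset ?_
  rintro w ⟨-, hl, hm⟩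
  refine ⟨w.attach.map fun a => ⟨a.1, hm a.1 a.2⟩, by
    rw [Set.mem_ofPred_eq, List.length_map, List.length_attach, hl], ?_⟩
  simp [Function.comp_def]

/-- The number `c_{n,m}(u)` of words in `C(u)` of length `n` with all letters at most `m`. -/
noncomputable def c (n m : ℕ) (u : List ℕ+) : ℕ :=
  (centralizerWords n m u).ncard

/-- The decreasing word `k (k-1) ⋯ 1`. -/
def descWord (k : ℕ) : List ℕ+ :=
  ((List.range k).map Nat.succPNat).reverse

end KnuthCentralizer

namespace KnuthCentralizer

/-! ### Knuth equivalence: congruence and invariants -/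

/-! Let all letters of `u` be at most `k`, and sort the words of `C(u)` of length `n` by their set
`S` of letters greater than `k`. An increasing relabelling that fixes `1, …, k` preserves Knuth
equivalence, so the size of a class depends only on `j = |S|`. Writing `N_j` for it, `c_{n,m}(u) =
∑_j (m-k choose j) N_j` for `m ≥ k`. If every word of `C(u)` of length `n` has at least `k` small
letters (letters at most `k`), then `N_j = 0` for `j > n - k`. The sum is then a polynomial in `m`
of degree `n - k` with leading coefficient `N_{n-k} / (n-k)!`, provided `N_{n-k} ≠ 0`.

It remains to bound the number of small letters and to find `N_{n-k}`, for `u = k⋯1` and for `u =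
12` (with `k = 2`). Both use two invariants of Knuth equivalence: the maximal lengths of weakly
increasing and of strictly decreasing subwords. Comparing `uw` with `wu`, a forbidden pattern in `w`
would turn each monotone subword of `w` into a longer one, which is absurd. For `n > k` this forces
a word counted by `N_{n-k}` to be strictly decreasing, hence equal to `n⋯1`; that word does commute
with `u`, since `n⋯1` commutes with every word in the letters `1, …, n`. So `N_{n-k} = 1`. For `n =
k` the count is direct: all `k^k` words on `1, …, k` for `u = k⋯1`, and the two words `12`, `21` for
`u = 12`. -/

theorem KnuthEquiv.refl (v : List ℕ+) : KnuthEquiv v v := Relation.EqvGen.refl v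

theorem KnuthEquiv.symm {v w : List ℕ+} (h : KnuthEquiv v w) : KnuthEquiv w v :=
  Relation.EqvGen.symm _ _ h

theorem KnuthEquiv.trans {u v w : List ℕ+} (h : KnuthEquiv u v) (h' : KnuthEquiv v w) :
    KnuthEquiv u w := Relation.EqvGen.trans _ _ _ h h'

theorem KnuthStep.equiv {v w : List ℕ+} (h : KnuthStep v w) : KnuthEquiv v w := .rel _ _ h

theorem KnuthStep.append {v w : List ℕ+} (h : KnuthStep v w) (p q : List ℕ+) :
    KnuthStep (p ++ v ++ q) (p ++ w ++ q) := by
  cases h with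
  | acb_cab x y a b c hab hbc => simpa using KnuthStep.acb_cab (p ++ x) (y ++ q) a b c hab hbc
  | bac_bca x y a b c hab hbc => simpa using KnuthStep.bac_bca (p ++ x) (y ++ q) a b c hab hbc

theorem KnuthEquiv.append {v w : List ℕ+} (h : KnuthEquiv v w) (p q : List ℕ+) :
    KnuthEquiv (p ++ v ++ q) (p ++ w ++ q) := by
  induction h with
  | rel _ _ h => exact .rel _ _ (h.append p q)
  | refl _ => exact .refl _
  | symm _ _ _ ih => exact ih.symm
  | trans _ _ _ _ _ ih₁ ih₂ => exact ih₁.trans ih₂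

theorem KnuthEquiv.cons {v w : List ℕ+} (h : KnuthEquiv v w) (a : ℕ+) :
    KnuthEquiv (a :: v) (a :: w) := by
  simpa using h.append [a] []

theorem KnuthStep.perm {v w : List ℕ+} (h : KnuthStep v w) : v.Perm w := by
  cases h with
  | acb_cab x y a b c _ _ =>
    exact ((List.Perm.swap c a [b]).append_left x).append_right y
  | bac_bca x y a b c _ _ =>
    exact (((List.Perm.swap c a []).cons b).append_left x).append_right y

theorem KnuthEquiv.perm {v w : List ℕ+} (h : KnuthEquiv v w) : v.Perm w := by
  induction h with
  | rel _ _ h => exact h.perm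
  | refl _ => exact .refl _
  | symm _ _ _ ih => exact ih.symm
  | trans _ _ _ _ _ ih₁ ih₂ => exact ih₁.trans ih₂

/-- Monotonicity on `A` is enough: Knuth moves permute letters, so every intermediate word stays in
`A`. -/
theorem KnuthEquiv.map {A : Set ℕ+} {f : ℕ+ → ℕ+} (hf : StrictMonoOn f A) {v w : List ℕ+}
    (h : KnuthEquiv v w) (hv : ∀ a ∈ v, a ∈ A) : KnuthEquiv (v.map f) (w.map f) := by
  induction h with
  | rel _ _ h =>
    cases h with
    | acb_cab x y a b c hab hbc =>
      have ha : a ∈ A := hv _ (by simp)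
      have hb : b ∈ A := hv _ (by simp)
      have hc : c ∈ A := hv _ (by simp)
      simpa using (KnuthStep.acb_cab (x.map f) (y.map f) (f a) (f b) (f c)
        (hf.monotoneOn ha hb hab) (hf hb hc hbc)).equiv
    | bac_bca x y a b c hab hbc =>
      have ha : a ∈ A := hv _ (by simp)
      have hb : b ∈ A := hv _ (by simp)
      have hc : c ∈ A := hv _ (by simp)
      simpa using (KnuthStep.bac_bca (x.map f) (y.map f) (f a) (f b) (f c)
        (hf ha hb hab) (hf.monotoneOn hb hc hbc)).equiv
  | refl _ => exact .refl _
  | symm v w h ih => exact (ih fun a ha => hv a ((KnuthEquiv.perm h).mem_iff.1 ha)).symm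
  | trans u v w h _ ih₁ ih₂ =>
    exact (ih₁ hv).trans (ih₂ fun a ha => hv a ((KnuthEquiv.perm h).mem_iff.2 ha))

/-- The subword of the letters at most `k`. -/
def small (k : ℕ) (w : List ℕ+) : List ℕ+ := w.filter fun a : ℕ+ => (a : ℕ) ≤ k

/-- The moved triple either survives whole or loses its largest letter `c`; in the latter case the
two sides of the move become equal. -/
theorem KnuthEquiv.small (k : ℕ) {v w : List ℕ+} (h : KnuthEquiv v w) :
    KnuthEquiv (small k v) (small k w) := by
  unfold KnuthCentralizer.small
  induction h with
  | rel _ _ h =>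
    cases h with
    | acb_cab x y a b c hab hbc =>
      have hab' : (a : ℕ) ≤ b := hab
      have hbc' : (b : ℕ) < c := hbc
      by_cases hc : (c : ℕ) ≤ k
      · simpa [hc, show (a : ℕ) ≤ k by omega, show (b : ℕ) ≤ k by omega] using
          (KnuthStep.acb_cab (x.filter fun a : ℕ+ => (a : ℕ) ≤ k)
            (y.filter fun a : ℕ+ => (a : ℕ) ≤ k) a b c hab hbc).equiv
      · simpa [hc, List.filter_cons] using KnuthEquiv.refl _
    | bac_bca x y a b c hab hbc =>
      have hab' : (a : ℕ) < b := hab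
      have hbc' : (b : ℕ) ≤ c := hbc
      by_cases hc : (c : ℕ) ≤ k
      · simpa [hc, show (a : ℕ) ≤ k by omega, show (b : ℕ) ≤ k by omega] using
          (KnuthStep.bac_bca (x.filter fun a : ℕ+ => (a : ℕ) ≤ k)
            (y.filter fun a : ℕ+ => (a : ℕ) ≤ k) a b c hab hbc).equiv
      · simpa [hc, List.filter_cons] using KnuthEquiv.refl _
  | refl _ => exact .refl _
  | symm _ _ _ ih => exact ih.symm
  | trans _ _ _ _ _ ih₁ ih₂ => exact ih₁.trans ih₂

/-- `v` has a subword of length `r` whose letters are pairwise in the relation `R`. -/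
def HasChain (R : ℕ+ → ℕ+ → Prop) (v : List ℕ+) (r : ℕ) : Prop :=
  ∃ t : List ℕ+, t.Sublist v ∧ t.Pairwise R ∧ t.length = r

/-- Local surgery: the part of a chain lying in the factor `v` is exchanged for one in `w` of the
same length. The last two conditions on `t'` let it be spliced to the parts in `x` and `y`. -/
theorem HasChain.replace {R : ℕ+ → ℕ+ → Prop} {x y v w : List ℕ+} {r : ℕ}
    (hvw : ∀ t : List ℕ+, t.Sublist v → t.Pairwise R → ∃ t' : List ℕ+, t'.Sublist w ∧ t'.Pairwise R ∧
      t'.length = t.length ∧ (∀ z, (∀ a ∈ t, R z a) → ∀ a ∈ t', R z a) ∧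
      (∀ z, (∀ a ∈ t, R a z) → ∀ a ∈ t', R a z))
    (h : HasChain R (x ++ v ++ y) r) : HasChain R (x ++ w ++ y) r := by
  obtain ⟨t, hs, hp, rfl⟩ := h
  obtain ⟨t₁₂, t₃, rfl, h₁₂, h₃⟩ := List.sublist_append_iff.1 hs
  obtain ⟨t₁, t₂, rfl, h₁, h₂⟩ := List.sublist_append_iff.1 h₁₂
  rw [List.pairwise_append, List.pairwise_append] at hp
  obtain ⟨⟨p₁, p₂, p₁₂⟩, p₃, p₁₃⟩ := hp
  obtain ⟨t', hs', hp', hl, hb, ha⟩ := hvw t₂ h₂ p₂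
  refine ⟨t₁ ++ t' ++ t₃, (h₁.append hs').append h₃, ?_, by simp [hl]⟩
  rw [List.pairwise_append, List.pairwise_append]
  refine ⟨⟨p₁, hp', fun a ha => hb a (p₁₂ a ha)⟩, p₃, fun a haa b hbb => ?_⟩
  rcases List.mem_append.1 haa with h | h
  · exact p₁₃ a (List.mem_append_left _ h) b hbb
  · exact ha b (fun a haa => p₁₃ a (List.mem_append_right _ haa) b hbb) a h

theorem sublist_three {t : List ℕ+} {a b c : ℕ+} (h : t.Sublist [a, b, c]) :
    t = [] ∨ t = [a] ∨ t = [b] ∨ t = [c] ∨ t = [a, b] ∨ t = [a, c] ∨ t = [b, c] ∨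
      t = [a, b, c] := by
  rw [← List.mem_sublists] at h
  simp [List.sublists] at h
  tauto

/-- Only the pair `a, c` changes order. A chain through both uses no `b`, and trading one of the two
for `b` repairs it: `ac` becomes `ab` in the first move and `bc` in the second. -/
theorem KnuthStep.hasChain_le_iff {v w : List ℕ+} (h : KnuthStep v w) (r : ℕ) :
    HasChain (· ≤ ·) v r ↔ HasChain (· ≤ ·) w r := by
  cases h with
  | acb_cab x y a b c hab hbc =>
    constructor <;> refine HasChain.replace fun t ht hp => ?_
    · rcases sublist_three ht with rfl | rfl | rfl | rfl | rfl | rfl | rfl | rfl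
      · exact ⟨[], by simp⟩
      · exact ⟨[a], by simp⟩
      · exact ⟨[c], by simp⟩
      · exact ⟨[b], by simp⟩
      · exact ⟨[a, b], by simp; grind⟩
      · exact ⟨[a, b], by simp; grind⟩
      · exact absurd hp (by simpa using hbc)
      · exact absurd hp (by simp [hbc])
    · rcases sublist_three ht with rfl | rfl | rfl | rfl | rfl | rfl | rfl | rfl
      · exact ⟨[], by simp⟩
      · exact ⟨[c], by simp⟩
      · exact ⟨[a], by simp⟩
      · exact ⟨[b], by simp⟩
      · exact absurd hp (by simpa using hab.trans_lt hbc)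
      · exact absurd hp (by simpa using hbc)
      · exact ⟨[a, b], by simp; grind⟩
      · exact absurd hp (by simp [hbc])
  | bac_bca x y a b c hab hbc =>
    constructor <;> refine HasChain.replace fun t ht hp => ?_
    · rcases sublist_three ht with rfl | rfl | rfl | rfl | rfl | rfl | rfl | rfl
      · exact ⟨[], by simp⟩
      · exact ⟨[b], by simp⟩
      · exact ⟨[a], by simp⟩
      · exact ⟨[c], by simp⟩
      · exact absurd hp (by simpa using hab)
      · exact ⟨[b, c], by simp; grind⟩
      · exact ⟨[b, c], by simp; grind⟩
      · exact absurd hp (by simp [hab])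
    · rcases sublist_three ht with rfl | rfl | rfl | rfl | rfl | rfl | rfl | rfl
      · exact ⟨[], by simp⟩
      · exact ⟨[b], by simp⟩
      · exact ⟨[c], by simp⟩
      · exact ⟨[a], by simp⟩
      · exact ⟨[b, c], by simp; grind⟩
      · exact absurd hp (by simpa using hab)
      · exact absurd hp (by simpa using hab.trans_le hbc)
      · exact absurd hp (by simp [hab])

/-- The same exchange for decreasing chains: `ca` becomes `cb` in the first move and `ba` in the
second. -/
theorem KnuthStep.hasChain_gt_iff {v w : List ℕ+} (h : KnuthStep v w) (r : ℕ) :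
    HasChain (· > ·) v r ↔ HasChain (· > ·) w r := by
  cases h with
  | acb_cab x y a b c hab hbc =>
    constructor <;> refine HasChain.replace fun t ht hp => ?_
    · rcases sublist_three ht with rfl | rfl | rfl | rfl | rfl | rfl | rfl | rfl
      · exact ⟨[], by simp⟩
      · exact ⟨[a], by simp⟩
      · exact ⟨[c], by simp⟩
      · exact ⟨[b], by simp⟩
      · exact absurd hp (by simpa using hab.trans hbc.le)
      · exact absurd hp (by simpa using hab)
      · exact ⟨[c, b], by simp; grind⟩
      · exact absurd hp (by simp; grind)
    · rcases sublist_three ht with rfl | rfl | rfl | rfl | rfl | rfl | rfl | rfl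
      · exact ⟨[], by simp⟩
      · exact ⟨[c], by simp⟩
      · exact ⟨[a], by simp⟩
      · exact ⟨[b], by simp⟩
      · exact ⟨[c, b], by simp; grind⟩
      · exact ⟨[c, b], by simp; grind⟩
      · exact absurd hp (by simpa using hab)
      · exact absurd hp (by simp; grind)
  | bac_bca x y a b c hab hbc =>
    constructor <;> refine HasChain.replace fun t ht hp => ?_
    · rcases sublist_three ht with rfl | rfl | rfl | rfl | rfl | rfl | rfl | rfl
      · exact ⟨[], by simp⟩
      · exact ⟨[b], by simp⟩
      · exact ⟨[a], by simp⟩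
      · exact ⟨[c], by simp⟩
      · exact ⟨[b, a], by simp; grind⟩
      · exact absurd hp (by simpa using hbc)
      · exact absurd hp (by simpa using (hab.trans_le hbc).le)
      · exact absurd hp (by simp; grind)
    · rcases sublist_three ht with rfl | rfl | rfl | rfl | rfl | rfl | rfl | rfl
      · exact ⟨[], by simp⟩
      · exact ⟨[b], by simp⟩
      · exact ⟨[c], by simp⟩
      · exact ⟨[a], by simp⟩
      · exact absurd hp (by simpa using hbc)
      · exact ⟨[b, a], by simp; grind⟩
      · exact ⟨[b, a], by simp; grind⟩
      · exact absurd hp (by simp; grind)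

theorem KnuthEquiv.hasChain_le_iff {v w : List ℕ+} (h : KnuthEquiv v w) (r : ℕ) :
    HasChain (· ≤ ·) v r ↔ HasChain (· ≤ ·) w r := by
  induction h with
  | rel _ _ h => exact h.hasChain_le_iff r
  | refl _ => exact .rfl
  | symm _ _ _ ih => exact ih.symm
  | trans _ _ _ _ _ ih₁ ih₂ => exact ih₁.trans ih₂

theorem KnuthEquiv.hasChain_gt_iff {v w : List ℕ+} (h : KnuthEquiv v w) (r : ℕ) :
    HasChain (· > ·) v r ↔ HasChain (· > ·) w r := by
  induction h with
  | rel _ _ h => exact h.hasChain_gt_iff r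
  | refl _ => exact .rfl
  | symm _ _ _ ih => exact ih.symm
  | trans _ _ _ _ _ ih₁ ih₂ => exact ih₁.trans ih₂

theorem KnuthEquiv.pairwise_le {v w : List ℕ+} (h : KnuthEquiv v w)
    (hv : v.Pairwise (· ≤ ·)) : w.Pairwise (· ≤ ·) := by
  obtain ⟨t, ht, hp, hl⟩ := (h.hasChain_le_iff v.length).1 ⟨v, .refl v, hv, rfl⟩
  rwa [ht.eq_of_length (hl.trans h.perm.length_eq)] at hp

/-! ### Decreasing words are central among the words in their letters -/

theorem descWord_succ (k : ℕ) : descWord (k + 1) = k.succPNat :: descWord k := by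
  simp [descWord, List.range_succ]

@[simp] theorem length_descWord (k : ℕ) : (descWord k).length = k := by simp [descWord]

theorem mem_descWord {k : ℕ} {a : ℕ+} : a ∈ descWord k ↔ (a : ℕ) ≤ k := by
  simp only [descWord, List.mem_reverse, List.mem_map, List.mem_range]
  constructor
  · rintro ⟨i, hi, rfl⟩
    simpa using hi
  · intro h
    exact ⟨a.natPred, by have := a.natPred_add_one; omega, by simp⟩

theorem pairwise_descWord (k : ℕ) : (descWord k).Pairwise (· > ·) := by
  induction k with
  | zero => simp [descWord]
  | succ k ih =>
    rw [descWord_succ, List.pairwise_cons]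
    refine ⟨fun a ha => ?_, ih⟩
    rw [mem_descWord] at ha
    rw [gt_iff_lt, ← PNat.coe_lt_coe]
    simpa using Nat.lt_succ_of_le ha

theorem eq_descWord {k : ℕ} {w : List ℕ+} (hw : w.Pairwise (· > ·)) (hk : ∀ a ∈ w, (a : ℕ) ≤ k)
    (hl : k ≤ w.length) : w = descWord k := by
  have hnd : w.Nodup := hw.imp fun h => h.ne'
  have hsub : w.Subperm (descWord k) := hnd.subperm fun a ha => mem_descWord.2 (hk a ha)
  have hp : w.Perm (descWord k) := hsub.perm_of_length_le (by simpa using hl)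
  exact hp.eq_of_pairwise (fun a b _ _ h h' => absurd h (not_lt.2 h'.le)) hw (pairwise_descWord k)

/-- The letter `c` moves right one place at a time by `bca → bac`, where `b` is the letter just to
its left and `a` the one just to its right. -/
theorem knuthEquiv_cons_cons_descWord (k : ℕ) (c : ℕ+) (h : k < (c : ℕ)) :
    KnuthEquiv (k.succPNat :: c :: descWord k) (k.succPNat :: (descWord k ++ [c])) := by
  induction k with
  | zero => exact .refl _
  | succ k ih =>
    rw [descWord_succ]
    have h₁ : KnuthStep ([] ++ [(k + 1).succPNat, k.succPNat, c] ++ descWord k)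
        ([] ++ [(k + 1).succPNat, c, k.succPNat] ++ descWord k) :=
      .bac_bca _ _ _ _ _ (by rw [← PNat.coe_lt_coe]; simp)
        (by rw [← PNat.coe_le_coe]; simpa using h)
    exact (KnuthEquiv.symm (.rel _ _ h₁)).trans ((ih (by omega)).cons _)

/-- If `a` is the top letter, this is the preceding lemma. Otherwise `a` passes the smaller
decreasing word by induction, and one move `cab → acb` carries it past the top letter. -/
theorem knuthEquiv_descWord_cons (k : ℕ) (a : ℕ+) (h : (a : ℕ) ≤ k) :
    KnuthEquiv (descWord k ++ [a]) (a :: descWord k) := by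
  induction k with
  | zero => exact absurd h (by simp)
  | succ k ih =>
    rw [descWord_succ]
    rcases Nat.lt_or_ge k a with hk | hk
    · have ha : a = k.succPNat := PNat.eq (by simp; omega)
      subst ha
      exact (knuthEquiv_cons_cons_descWord k _ hk).symm
    · obtain ⟨j, rfl⟩ : ∃ j, k = j + 1 := ⟨k - 1, by have := a.pos; omega⟩
      refine ((ih hk).cons _).trans (.symm ?_)
      rw [descWord_succ]
      exact .rel _ _ (KnuthStep.acb_cab [] (descWord j) a j.succPNat (j + 1).succPNat
        (by rw [← PNat.coe_le_coe]; simpa using hk) (by rw [← PNat.coe_lt_coe]; simp))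

theorem knuthEquiv_descWord_append (k : ℕ) (w : List ℕ+) (h : ∀ a ∈ w, (a : ℕ) ≤ k) :
    KnuthEquiv (descWord k ++ w) (w ++ descWord k) := by
  induction w with
  | nil => simpa using KnuthEquiv.refl _
  | cons a w ih =>
    have h₁ := (knuthEquiv_descWord_cons k a (h a (by simp))).append [] w
    have h₂ := (ih fun b hb => h b (by simp [hb])).cons a
    simpa using h₁.trans (by simpa using h₂)

/-! ### Counting the centralizer by the set of large letters -/

/-- The letters `k + 1, …, k + j`. -/
def largeLetters (k j : ℕ) : Finset ℕ+ :=
  (Finset.range j).image fun i => (k + i).succPNat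

@[simp] theorem card_largeLetters (k j : ℕ) : (largeLetters k j).card = j := by
  rw [largeLetters, Finset.card_image_of_injective _ fun i i' h => by
    simpa using congrArg PNat.val h, Finset.card_range]

theorem mem_largeLetters {k j : ℕ} {a : ℕ+} :
    a ∈ largeLetters k j ↔ k < (a : ℕ) ∧ (a : ℕ) ≤ k + j := by
  simp only [largeLetters, Finset.mem_image, Finset.mem_range]
  constructor
  · rintro ⟨i, hi, rfl⟩
    rw [Nat.succPNat_coe]
    omega
  · rintro ⟨h, h'⟩
    refine ⟨a - k - 1, by omega, PNat.eq ?_⟩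
    rw [Nat.succPNat_coe]
    omega

/-- The words of length `n` in `C(u)` whose set of letters greater than `k` is `S`. -/
def centralizerFiber (n k : ℕ) (u : List ℕ+) (S : Finset ℕ+) : Set (List ℕ+) :=
  {w | w ∈ centralizer u ∧ w.length = n ∧ ∀ a, a ∈ S ↔ a ∈ w ∧ k < (a : ℕ)}

theorem centralizerFiber_finite (n k : ℕ) (u : List ℕ+) (S : Finset ℕ+) :
    (centralizerFiber n k u S).Finite := by
  refine (centralizerWords_finite n (k + S.sup PNat.val) u).subset ?_
  rintro w ⟨h, hl, hS⟩
  refine ⟨h, hl, fun a ha => ?_⟩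
  by_cases hk : k < (a : ℕ)
  · have : (a : ℕ) ≤ S.sup PNat.val := Finset.le_sup (f := PNat.val) ((hS a).2 ⟨ha, hk⟩)
    omega
  · omega

theorem exists_relabelling (k : ℕ) {S T : Finset ℕ+} (hS : ∀ a ∈ S, k < (a : ℕ))
    (hT : ∀ a ∈ T, k < (a : ℕ)) (h : S.card = T.card) :
    ∃ f : ℕ+ → ℕ+, StrictMonoOn f {a | (a : ℕ) ≤ k ∨ a ∈ S} ∧ (∀ a : ℕ+, (a : ℕ) ≤ k → f a = a) ∧
      S.image f = T := by
  let e : S ≃o T := (S.orderIsoOfFin h).symm.trans (T.orderIsoOfFin rfl)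
  -- Off `S` the map is the identity, which fixes the letters up to `k`; monotonicity may fail at
  -- large letters outside `S`.
  let f : ℕ+ → ℕ+ := fun a => if ha : a ∈ S then e ⟨a, ha⟩ else a
  have hfS : ∀ a (ha : a ∈ S), f a = e ⟨a, ha⟩ := fun a ha => dif_pos ha
  have hfk : ∀ a : ℕ+, (a : ℕ) ≤ k → f a = a := fun a ha =>
    dif_neg fun h => absurd (hS a h) (by omega)
  refine ⟨f, ?_, hfk, ?_⟩
  · rintro a (ha | ha) b (hb | hb) hab
    · rwa [hfk a ha, hfk b hb]
    · rw [hfk a ha, hfS b hb, ← PNat.coe_lt_coe]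
      exact ha.trans_lt (hT _ (e ⟨b, hb⟩).2)
    · have := hS a ha
      have : (a : ℕ) < b := hab
      omega
    · rw [hfS a ha, hfS b hb]
      exact e.lt_iff_lt.2 hab
  · ext b
    rw [Finset.mem_image]
    constructor
    · rintro ⟨a, ha, rfl⟩
      rw [hfS a ha]
      exact (e ⟨a, ha⟩).2
    · intro hb
      refine ⟨e.symm ⟨b, hb⟩, (e.symm ⟨b, hb⟩).2, ?_⟩
      rw [hfS _ (e.symm ⟨b, hb⟩).2]
      simp

theorem ncard_centralizerFiber_le (n : ℕ) {k : ℕ} {u : List ℕ+} (hu : ∀ a ∈ u, (a : ℕ) ≤ k)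
    {S T : Finset ℕ+} (hS : ∀ a ∈ S, k < (a : ℕ)) (hT : ∀ a ∈ T, k < (a : ℕ))
    (h : S.card = T.card) :
    (centralizerFiber n k u S).ncard ≤ (centralizerFiber n k u T).ncard := by
  obtain ⟨f, hf, hfk, hfS⟩ := exists_relabelling k hS hT h
  have hw : ∀ w ∈ centralizerFiber n k u S, ∀ a ∈ w, a ∈ {a : ℕ+ | (a : ℕ) ≤ k ∨ a ∈ S} := by
    rintro w ⟨-, -, hwS⟩ a ha
    rcases Nat.lt_or_ge k a with hk | hk
    · exact .inr ((hwS a).2 ⟨ha, hk⟩)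
    · exact .inl hk
  refine Set.ncard_le_ncard_of_injOn (List.map f) ?_ ?_ (centralizerFiber_finite n k u T)
  · rintro w hw'
    obtain ⟨hc, hl, hwS⟩ := id hw'
    have huf : u.map f = u := by
      conv_rhs => rw [← List.map_id u]
      exact List.map_congr_left fun a ha => hfk a (hu a ha)
    refine ⟨?_, by simpa using hl, fun b => ?_⟩
    · have := KnuthEquiv.map hf hc (by
        intro a ha
        rcases List.mem_append.1 ha with ha | ha
        · exact .inl (hu a ha)
        · exact hw w hw' a ha)
      rwa [List.map_append, List.map_append, huf] at this
    · constructor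
      · intro hb
        refine ⟨?_, hT b hb⟩
        rw [← hfS, Finset.mem_image] at hb
        obtain ⟨a, ha, rfl⟩ := hb
        exact List.mem_map_of_mem ((hwS a).1 ha).1
      · rintro ⟨hb, hbk⟩
        obtain ⟨a, ha, rfl⟩ := List.mem_map.1 hb
        rcases hw w hw' a ha with hak | haS
        · rw [hfk a hak] at hbk
          exact absurd hbk (not_lt.2 hak)
        · rw [← hfS]
          exact Finset.mem_image_of_mem f haS
  · intro v hv w hw' hvw
    have hinj := hf.injOn
    clear hf
    have h₁ := hw v hv
    have h₂ := hw w hw'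
    clear hv hw' hw
    induction v generalizing w with
    | nil => simpa using hvw
    | cons a v ih =>
      cases w with
      | nil => simp at hvw
      | cons b w =>
        rw [List.map_cons, List.map_cons, List.cons.injEq] at hvw
        rw [hinj (h₁ a (by simp)) (h₂ b (by simp)) hvw.1,
          ih hvw.2 (fun a ha => h₁ a (by simp [ha])) (fun a ha => h₂ a (by simp [ha]))]

theorem ncard_centralizerFiber_eq (n : ℕ) {k : ℕ} {u : List ℕ+} (hu : ∀ a ∈ u, (a : ℕ) ≤ k)
    {S : Finset ℕ+} (hS : ∀ a ∈ S, k < (a : ℕ)) :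
    (centralizerFiber n k u S).ncard = (centralizerFiber n k u (largeLetters k S.card)).ncard := by
  have hT : ∀ a ∈ largeLetters k S.card, k < (a : ℕ) := fun a ha => (mem_largeLetters.1 ha).1
  exact le_antisymm (ncard_centralizerFiber_le n hu hS hT (by simp))
    (ncard_centralizerFiber_le n hu hT hS (by simp))

theorem c_eq_sum_choose (n : ℕ) {k m : ℕ} {u : List ℕ+} (hu : ∀ a ∈ u, (a : ℕ) ≤ k) (hkm : k ≤ m) :
    c n m u = ∑ j ∈ Finset.range (m - k + 1),
      (m - k).choose j * (centralizerFiber n k u (largeLetters k j)).ncard := by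
  classical
  let F := (centralizerWords_finite n m u).toFinset
  let large : List ℕ+ → Finset ℕ+ := fun w => w.toFinset.filter fun a : ℕ+ => k < (a : ℕ)
  have hF : c n m u = F.card := Set.ncard_eq_toFinset_card _ _
  have hmaps : ∀ w ∈ F, large w ∈ (largeLetters k (m - k)).powerset := by
    intro w hw
    obtain ⟨-, -, hm⟩ := (Set.Finite.mem_toFinset _).1 hw
    rw [Finset.mem_powerset]
    intro a ha
    simp only [large, Finset.mem_filter, List.mem_toFinset] at ha
    have := hm a ha.1
    exact mem_largeLetters.2 ⟨ha.2, by omega⟩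
  rw [hF, Finset.card_eq_sum_card_fiberwise hmaps]
  have hfib : ∀ S ∈ (largeLetters k (m - k)).powerset, (F.filter fun w => large w = S).card =
      (fun j => (centralizerFiber n k u (largeLetters k j)).ncard) S.card := by
    intro S hS
    rw [Finset.mem_powerset] at hS
    have hSk : ∀ a ∈ S, k < (a : ℕ) := fun a ha => (mem_largeLetters.1 (hS ha)).1
    dsimp only
    rw [← ncard_centralizerFiber_eq n hu hSk, ← Set.ncard_coe_finset]
    congr 1
    ext w
    simp only [F, large, centralizerFiber, centralizerWords, Finset.coe_filter,
      Set.Finite.mem_toFinset, Set.mem_ofPred_eq, Finset.ext_iff, Finset.mem_filter,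
      List.mem_toFinset]
    constructor
    · rintro ⟨⟨h, hl, -⟩, hS'⟩
      exact ⟨h, hl, fun a => (hS' a).symm⟩
    · rintro ⟨h, hl, hS'⟩
      refine ⟨⟨h, hl, fun a ha => ?_⟩, fun a => (hS' a).symm⟩
      rcases Nat.lt_or_ge k a with hk | hk
      · have := (mem_largeLetters.1 (hS ((hS' a).2 ⟨ha, hk⟩))).2
        omega
      · omega
  rw [Finset.sum_congr rfl hfib, Finset.sum_powerset_apply_card
    (fun j => (centralizerFiber n k u (largeLetters k j)).ncard), card_largeLetters]
  simp

theorem length_eq_small_add (k : ℕ) (w : List ℕ+) :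
    w.length = (small k w).length + (w.filter fun a : ℕ+ => k < (a : ℕ)).length := by
  rw [small, List.length_eq_length_filter_add (l := w) fun a => decide ((a : ℕ) ≤ k)]
  simp [← decide_not]

/-- There is no room for `k` small letters and `j` distinct large ones in length `n`. -/
theorem ncard_centralizerFiber_eq_zero {n k j : ℕ} {u : List ℕ+}
    (h : ∀ w ∈ centralizer u, w.length = n → k ≤ (small k w).length) (hj : n < k + j) :
    (centralizerFiber n k u (largeLetters k j)).ncard = 0 := by
  rw [Set.ncard_eq_zero (centralizerFiber_finite _ _ _ _), Set.eq_empty_iff_forall_notMem]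
  rintro w ⟨hc, hl, hS⟩
  have h₁ := h w hc hl
  have h₂ := length_eq_small_add k w
  have h₃ : (largeLetters k j).card ≤ (w.filter fun a : ℕ+ => k < (a : ℕ)).toFinset.card :=
    Finset.card_le_card fun a ha => by simpa using (hS a).1 ha
  have h₄ := List.toFinset_card_le (w.filter fun a : ℕ+ => k < (a : ℕ))
  rw [card_largeLetters] at h₃
  omega

theorem exists_polynomial {n k N : ℕ} {u : List ℕ+} (hkn : k ≤ n) (hu : ∀ a ∈ u, (a : ℕ) ≤ k)
    (h : ∀ w ∈ centralizer u, w.length = n → k ≤ (small k w).length)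
    (hN : (centralizerFiber n k u (largeLetters k (n - k))).ncard = N) (hN0 : N ≠ 0) :
    ∃ p : ℚ[X], (∀ m : ℕ, n ≤ m → (c n m u : ℚ) = p.eval (m : ℚ)) ∧
      p.degree = ((n - k : ℕ) : WithBot ℕ) ∧ p.leadingCoeff = N / ((n - k)! : ℚ) := by
  let a : ℕ → ℚ := fun j => (centralizerFiber n k u (largeLetters k j)).ncard / (j ! : ℚ)
  -- `q j` is the falling factorial `(X-k)(X-k-1)⋯(X-k-j+1)`, so `q j / j!` takes the value `(m-k
  -- choose j)` at `m`.
  let q : ℕ → ℚ[X] := fun j => (descPochhammer ℚ j).comp (X - C (k : ℚ))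
  have hq : ∀ j, (q j).Monic ∧ (q j).natDegree = j := fun j =>
    ⟨(monic_descPochhammer ℚ j).comp_X_sub_C _, by
      rw [natDegree_comp, natDegree_X_sub_C, descPochhammer_natDegree, mul_one]⟩
  have hqd : ∀ j, (q j).degree = j := fun j => by
    rw [degree_eq_natDegree (hq j).1.ne_zero, (hq j).2]
  have ha : a (n - k) ≠ 0 := by
    simp only [a, hN]
    positivity
  have hlow : (∑ j ∈ Finset.range (n - k), C (a j) * q j).degree <
      (C (a (n - k)) * q (n - k)).degree := by
    rw [degree_C_mul ha, hqd]
    refine (degree_sum_le _ _).trans_lt ((Finset.sup_lt_iff (by simp)).2 fun j hj => ?_)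
    refine ((degree_mul_le _ _).trans (add_le_add_left degree_C_le _)).trans_lt ?_
    rw [zero_add, hqd]
    exact_mod_cast Finset.mem_range.1 hj
  refine ⟨∑ j ∈ Finset.range (n - k + 1), C (a j) * q j, fun m hm => ?_, ?_, ?_⟩
  · have hsub : Finset.range (n - k + 1) ⊆ Finset.range (m - k + 1) :=
      Finset.range_subset_range.2 (by omega)
    rw [c_eq_sum_choose n hu (hkn.trans hm), ← Finset.sum_subset hsub, eval_finsetSum,
      Nat.cast_sum]
    · refine Finset.sum_congr rfl fun j _ => ?_
      have hcast : (m : ℚ) - k = ((m - k : ℕ) : ℚ) := by rw [Nat.cast_sub (hkn.trans hm)]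
      rw [eval_mul, eval_C, eval_comp, eval_sub, eval_X, eval_C, hcast,
        descPochhammer_eval_eq_descFactorial, Nat.descFactorial_eq_factorial_mul_choose]
      have : (j ! : ℚ) ≠ 0 := by positivity
      simp only [a]
      push_cast
      field_simp
    · intro j _ hj
      rw [Finset.mem_range] at hj
      rw [ncard_centralizerFiber_eq_zero h (by omega), mul_zero]
  · rw [Finset.sum_range_succ, degree_add_eq_right_of_degree_lt hlow, degree_C_mul ha, hqd]
  · rw [Finset.sum_range_succ, leadingCoeff_add_of_degree_lt hlow, leadingCoeff_mul,
      leadingCoeff_C, (hq _).1.leadingCoeff, mul_one]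
    simp only [a, hN]

/-! ### Words with few small letters in the centralizers -/

theorem mem_small {k : ℕ} {w : List ℕ+} {a : ℕ+} : a ∈ small k w ↔ a ∈ w ∧ (a : ℕ) ≤ k := by
  simp [small]

theorem small_append (k : ℕ) (v w : List ℕ+) : small k (v ++ w) = small k v ++ small k w := by
  simp [small]

theorem small_eq_self {k : ℕ} {w : List ℕ+} (h : ∀ a ∈ w, (a : ℕ) ≤ k) : small k w = w := by
  simpa [small] using h

theorem small_sublist {k : ℕ} {v w : List ℕ+} (h : v.Sublist w) :
    (small k v).Sublist (small k w) := h.filter _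

theorem small_mem_centralizer {k : ℕ} {u w : List ℕ+} (hu : ∀ a ∈ u, (a : ℕ) ≤ k)
    (h : w ∈ centralizer u) : small k w ∈ centralizer u := by
  have := KnuthEquiv.small k h
  rwa [small_append, small_append, small_eq_self hu] at this

/-- This replaces the choice of a longest chain: a chain that can always be lengthened would outgrow
`w`. -/
theorem not_forall_hasChain {R : ℕ+ → ℕ+ → Prop} {w : List ℕ+} {r₀ : ℕ} (h₀ : HasChain R w r₀)
    (h : ∀ r, r₀ ≤ r → HasChain R w r → HasChain R w (r + 1)) : False := by
  have : ∀ i, HasChain R w (r₀ + i) := fun i => by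
    induction i with
    | zero => exact h₀
    | succ i ih => exact h _ (Nat.le_add_right _ _) ih
  obtain ⟨t, ht, -, hl⟩ := this (w.length + 1)
  have := ht.length_le
  omega

theorem pairwise_gt_of_not_hasChain {w : List ℕ+} (h : ¬ HasChain (· ≤ ·) w 2) :
    w.Pairwise (· > ·) := by
  rw [List.pairwise_iff_forall_sublist]
  intro a b hab
  by_contra hlt
  exact h ⟨[a, b], hab, by simpa using hlt, rfl⟩

theorem length_le_of_pairwise_gt {k : ℕ} {w : List ℕ+} (hw : w.Pairwise (· > ·))
    (hk : ∀ a ∈ w, (a : ℕ) ≤ k) : w.length ≤ k := by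
  have hnd : w.Nodup := hw.imp fun h => h.ne'
  simpa using (hnd.subperm fun a ha => mem_descWord.2 (hk a ha)).length_le

/-- Append `k⋯1` to a decreasing chain `t` of large letters of `w`. The invariant gives an equally
long chain in `k⋯1 w`; starting in the prefix it would have at most `k` letters, so it lies in `w`.
If `k⋯1` is not a subword of `w`, fewer than `k` of its letters are small, so it has more large
letters than `t`. -/
theorem descWord_sublist_of_mem_centralizer {k : ℕ} {w : List ℕ+}
    (hw : w ∈ centralizer (descWord k)) {x : ℕ+} (hx : x ∈ w) (hxk : k < (x : ℕ)) :
    (descWord k).Sublist (small k w) := by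
  by_contra hcon
  refine not_forall_hasChain (R := (· > ·)) (w := w.filter fun a : ℕ+ => k < (a : ℕ)) (r₀ := 1)
    ⟨[x], by simpa using ⟨hx, hxk⟩, by simp, rfl⟩ ?_
  rintro r hr ⟨t, ht, hp, rfl⟩
  have htk : ∀ a ∈ t, k < (a : ℕ) := fun a ha => by simpa using (List.mem_filter.1 (ht.subset ha)).2
  obtain ⟨s, hs, hsp, hsl⟩ := (KnuthEquiv.hasChain_gt_iff hw (t.length + k)).2
    ⟨t ++ descWord k, (ht.trans List.filter_sublist).append (.refl _), by
      rw [List.pairwise_append]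
      refine ⟨hp, pairwise_descWord k, fun a ha b hb => ?_⟩
      rw [gt_iff_lt, ← PNat.coe_lt_coe]
      exact (mem_descWord.1 hb).trans_lt (htk a ha), by simp⟩
  obtain ⟨s₁, s₂, rfl, h₁, h₂⟩ := List.sublist_append_iff.1 hs
  cases s₁ with
  | nil =>
    rw [List.nil_append] at hsp hsl
    have h₃ := length_eq_small_add k s₂
    have h₄ : (small k s₂).length < k := by
      by_contra hlen
      have := eq_descWord (hsp.filter _) (fun a ha => (mem_small.1 ha).2) (not_lt.1 hlen)
      exact hcon (this ▸ small_sublist h₂)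
    have h₅ : t.length + 1 ≤ (s₂.filter fun a : ℕ+ => k < (a : ℕ)).length := by omega
    exact ⟨(s₂.filter fun a : ℕ+ => k < (a : ℕ)).take (t.length + 1),
      (List.take_sublist _ _).trans (h₂.filter _),
      (hsp.filter _).sublist (List.take_sublist _ _), by simpa using h₅⟩
  | cons a s₁ =>
    have hak : (a : ℕ) ≤ k := mem_descWord.1 (h₁.subset (by simp))
    have := length_le_of_pairwise_gt hsp (k := k) (by
      intro b hb
      rw [List.cons_append, List.mem_cons] at hb
      rcases hb with rfl | hb
      · exact hak
      · have := List.rel_of_pairwise_cons hsp hb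
        have : (b : ℕ) < a := this
        omega)
    omega

theorem le_length_small_of_mem_centralizer_descWord {k : ℕ} {w : List ℕ+}
    (hw : w ∈ centralizer (descWord k)) (hl : k ≤ w.length) : k ≤ (small k w).length := by
  by_cases h : ∃ x ∈ w, k < (x : ℕ)
  · obtain ⟨x, hx, hxk⟩ := h
    simpa using (descWord_sublist_of_mem_centralizer hw hx hxk).length_le
  · push Not at h
    rwa [small_eq_self h]

/-- Here the small letters of `w` spell `k⋯1`. Putting `1` before a weak chain of length `r ≥ 2` in
`w` gives a chain of length `r + 1` in `k⋯1 w`, hence in `w k⋯1`. If it met the suffix, it would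
consist of small letters, with at most one from each factor: too short. So it lies in `w`. -/
theorem pairwise_gt_of_mem_centralizer_descWord {k : ℕ} (hk : 1 ≤ k) {w : List ℕ+}
    (hw : w ∈ centralizer (descWord k)) {x : ℕ+} (hx : x ∈ w) (hxk : k < (x : ℕ))
    (hs : (small k w).length = k) : w.Pairwise (· > ·) := by
  have hsk : small k w = descWord k :=
    ((descWord_sublist_of_mem_centralizer hw hx hxk).eq_of_length (by simp [hs])).symm
  refine pairwise_gt_of_not_hasChain fun h₂ => not_forall_hasChain h₂ ?_
  have one_le : ∀ {t : List ℕ+}, t.Sublist (descWord k) → t.Pairwise (· ≤ ·) → t.length ≤ 1 := by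
    intro t ht hp
    match t, ht, hp with
    | [], _, _ => simp
    | [a], _, _ => simp
    | a :: b :: t, ht, hp =>
      have h₁ : b < a := List.rel_of_pairwise_cons ((pairwise_descWord k).sublist ht) (by simp)
      exact absurd (List.rel_of_pairwise_cons hp (by simp)) (not_le.2 h₁)
  rintro r hr ⟨t, ht, hp, rfl⟩
  obtain ⟨s, hs, hsp, hsl⟩ := (KnuthEquiv.hasChain_le_iff hw (t.length + 1)).1
    ⟨[1] ++ t, (List.singleton_sublist.2 (mem_descWord.2 (by simpa using hk))).append ht, by
      simpa using hp, by simp⟩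
  obtain ⟨s₁, s₂, rfl, h₁, h₂⟩ := List.sublist_append_iff.1 hs
  cases hs₂ : s₂ with
  | nil => exact ⟨s₁, h₁, by simpa [hs₂] using hsp, by simpa [hs₂] using hsl⟩
  | cons d s₂' =>
    rw [List.pairwise_append] at hsp
    have hl₂ := one_le h₂ hsp.2.1
    have hd : d ∈ s₂ := by simp [hs₂]
    have hs₁ : ∀ a ∈ s₁, (a : ℕ) ≤ k := fun a ha =>
      (PNat.coe_le_coe _ _ |>.2 (hsp.2.2 a ha d hd)).trans (mem_descWord.1 (h₂.subset hd))
    have h₃ := small_sublist (k := k) h₁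
    rw [small_eq_self hs₁, hsk] at h₃
    have hl₁ := one_le h₃ hsp.1
    rw [List.length_append] at hsl
    omega

/-- All `n - k` large letters occur, leaving at most `k` places for small ones. -/
theorem length_small_eq {n k : ℕ} {u w : List ℕ+} (hkn : k ≤ n)
    (hw : w ∈ centralizerFiber n k u (largeLetters k (n - k))) (h : k ≤ (small k w).length) :
    (small k w).length = k := by
  obtain ⟨-, hl, hS⟩ := hw
  have h₂ := length_eq_small_add k w
  have h₃ : (largeLetters k (n - k)).card ≤ (w.filter fun a : ℕ+ => k < (a : ℕ)).toFinset.card :=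
    Finset.card_le_card fun a ha => by simpa using (hS a).1 ha
  have h₄ := List.toFinset_card_le (w.filter fun a : ℕ+ => k < (a : ℕ))
  rw [card_largeLetters] at h₃
  omega

theorem le_of_mem_centralizerFiber {n k : ℕ} {u w : List ℕ+} (hkn : k ≤ n)
    (hw : w ∈ centralizerFiber n k u (largeLetters k (n - k))) {a : ℕ+} (ha : a ∈ w) :
    (a : ℕ) ≤ n := by
  rcases Nat.lt_or_ge k a with hk | hk
  · have := (mem_largeLetters.1 ((hw.2.2 a).2 ⟨ha, hk⟩)).2
    omega
  · omega

theorem exists_large_mem {n k : ℕ} {u w : List ℕ+} (hkn : k < n)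
    (hw : w ∈ centralizerFiber n k u (largeLetters k (n - k))) : ∃ x ∈ w, k < (x : ℕ) :=
  ⟨⟨n, by omega⟩, (hw.2.2 _).1 (mem_largeLetters.2 (by rw [PNat.mk_coe]; omega))⟩

theorem centralizerFiber_eq_singleton {n k : ℕ} {u : List ℕ+} (hkn : k ≤ n)
    (hu : ∀ a ∈ u, (a : ℕ) ≤ k)
    (h : ∀ w ∈ centralizerFiber n k u (largeLetters k (n - k)), w.Pairwise (· > ·)) :
    centralizerFiber n k u (largeLetters k (n - k)) = {descWord n} := by
  ext w
  rw [Set.mem_singleton_iff]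
  constructor
  · intro hw
    exact eq_descWord (h w hw) (fun a ha => le_of_mem_centralizerFiber hkn hw ha) hw.2.1.ge
  · rintro rfl
    refine ⟨(knuthEquiv_descWord_append n u fun a ha => (hu a ha).trans hkn).symm, by simp,
      fun a => ?_⟩
    rw [mem_largeLetters, mem_descWord]
    omega

theorem ncard_words (n k : ℕ) : {w : List ℕ+ | w.length = n ∧ ∀ a ∈ w, (a : ℕ) ≤ k}.ncard =
    k ^ n := by
  let f : (Fin n → Fin k) → List ℕ+ := fun g => List.ofFn fun i => (g i : ℕ).succPNat
  have hf : Function.Injective f := fun g g' h => by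
    have := List.ofFn_injective h
    funext i
    exact Fin.ext (by simpa using congrArg PNat.val (congrFun this i))
  have : {w : List ℕ+ | w.length = n ∧ ∀ a ∈ w, (a : ℕ) ≤ k} = Set.range f := by
    ext w
    constructor
    · rintro ⟨rfl, hk⟩
      refine ⟨fun i => ⟨(w.get i).natPred, ?_⟩, ?_⟩
      · have := hk _ (w.get_mem i)
        have := (w.get i).natPred_add_one
        omega
      · simp [f]
    · rintro ⟨g, rfl⟩
      refine ⟨by simp [f], fun a ha => ?_⟩
      obtain ⟨i, rfl⟩ := (List.mem_ofFn' _ _).1 ha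
      simp
  rw [this, Set.ncard_range_of_injective hf]
  simp

/-! ### The centralizer of `12` -/

/-- In each excluded case exactly one of `12w` and `w12` is weakly increasing. -/
theorem mem_centralizer_one_two_of_small {w : List ℕ+} (hw : w ∈ centralizer [1, 2])
    (h : ∀ a ∈ w, (a : ℕ) ≤ 2) (hl : w.length ≤ 2) : w = [] ∨ w = [1, 2] ∨ w = [2, 1] := by
  have h12 : ∀ a : ℕ+, (a : ℕ) ≤ 2 → a = 1 ∨ a = 2 := fun a ha => by
    have := a.pos
    rcases (by omega : (a : ℕ) = 1 ∨ (a : ℕ) = 2) with h | h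
    · exact .inl (PNat.eq h)
    · exact .inr (PNat.eq h)
  match w, hl with
  | [], _ => exact .inl rfl
  | [a], _ =>
    exfalso
    rcases h12 a (h a (by simp)) with rfl | rfl
    · exact absurd (KnuthEquiv.pairwise_le (KnuthEquiv.symm hw) (by simp)) (by decide)
    · exact absurd (KnuthEquiv.pairwise_le hw (by simp)) (by decide)
  | [a, b], _ =>
    rcases h12 a (h a (by simp)) with rfl | rfl <;> rcases h12 b (h b (by simp)) with rfl | rfl
    · exact absurd (KnuthEquiv.pairwise_le (KnuthEquiv.symm hw) (by simp)) (by decide)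
    · simp
    · simp
    · exact absurd (KnuthEquiv.pairwise_le hw (by simp)) (by decide)

/-- With fewer than two small letters, `w` has none, since its small part also commutes with `12`.
Then `12t` is a chain in `12w` for each weak chain `t` of `w`, and an equally long chain in `w12`
cannot combine letters of `w` with the suffix. -/
theorem two_le_length_small_of_mem_centralizer {w : List ℕ+} (hw : w ∈ centralizer [1, 2])
    (hl : 1 ≤ w.length) : 2 ≤ (small 2 w).length := by
  by_contra hcon
  have hs : small 2 w = [] := by
    rcases mem_centralizer_one_two_of_small (small_mem_centralizer (k := 2) (by simp) hw)
      (fun a ha => (mem_small.1 ha).2) (by omega) with h | h | h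
    · exact h
    all_goals simp [h] at hcon
  obtain ⟨x, hx⟩ := List.exists_mem_of_length_pos hl
  refine not_forall_hasChain (R := (· ≤ ·)) (w := w) (r₀ := 1)
    ⟨[x], by simpa using hx, by simp, rfl⟩ ?_
  rintro r hr ⟨t, ht, hp, rfl⟩
  have hbig : ∀ a ∈ w, 2 < (a : ℕ) := fun a ha => by
    by_contra hle
    have : a ∈ small 2 w := mem_small.2 ⟨ha, by omega⟩
    simp [hs] at this
  obtain ⟨s, hs, hsp, hsl⟩ := (KnuthEquiv.hasChain_le_iff hw (t.length + 2)).1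
    ⟨[1, 2] ++ t, (List.Sublist.refl _).append ht, by
      rw [List.pairwise_append]
      refine ⟨by simp, hp, fun a ha b hb => ?_⟩
      have := hbig b (ht.subset hb)
      rw [← PNat.coe_le_coe]
      rcases (by simpa using ha : a = 1 ∨ a = 2) with rfl | rfl
      · exact b.pos
      · exact this.le, by simp⟩
  obtain ⟨s₁, s₂, rfl, h₁, h₂⟩ := List.sublist_append_iff.1 hs
  rw [List.pairwise_append] at hsp
  rw [List.length_append] at hsl
  have hl₂ : s₂.length ≤ 2 := h₂.length_le
  cases hs₁ : s₁ with
  | nil => simp [hs₁] at hsl; omega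
  | cons a s₁' =>
    have ha : a ∈ s₁ := by simp [hs₁]
    have hs₂ : s₂ = [] := List.eq_nil_iff_forall_not_mem.2 fun b hb => by
      have h₃ : (a : ℕ) ≤ b := hsp.2.2 a ha b hb
      have h₄ := hbig a (h₁.subset ha)
      rcases (by simpa using h₂.subset hb : b = 1 ∨ b = 2) with rfl | rfl
      · exact absurd h₃ (by simp; omega)
      · exact absurd (h₄.trans_le h₃) (by decide)
    rw [hs₂, List.length_nil] at hsl
    exact ⟨s₁.take (t.length + 1), (List.take_sublist _ _).trans h₁,
      hsp.1.sublist (List.take_sublist _ _), by simp; omega⟩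

theorem pairwise_gt_of_mem_centralizer_one_two {w : List ℕ+} (hw : w ∈ centralizer [1, 2])
    (hl : 3 ≤ w.length) (h_len : (small 2 w).length = 2) : w.Pairwise (· > ·) := by
  have hsmall : small 2 w = [1, 2] ∨ small 2 w = [2, 1] := by
    rcases mem_centralizer_one_two_of_small (small_mem_centralizer (k := 2) (by simp) hw)
      (fun a ha => (mem_small.1 ha).2) h_len.le with h | h
    · simp [h] at h_len
    · exact h
  -- A chain in `w12` that meets the suffix has only small letters, of which `w12` contains four; it
  -- would be all of `1212` or `2112`, neither of them increasing.
  have hstep : ∀ r, 4 ≤ r → HasChain (· ≤ ·) ([1, 2] ++ w) r → HasChain (· ≤ ·) w r := by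
    rintro r hr hch
    obtain ⟨s, hs, hsp, rfl⟩ := (KnuthEquiv.hasChain_le_iff hw r).1 hch
    obtain ⟨s₁, s₂, rfl, h₁, h₂⟩ := List.sublist_append_iff.1 hs
    cases hs₂ : s₂ with
    | nil => exact ⟨s₁, h₁, by simpa [hs₂] using hsp, by simp⟩
    | cons d s₂' =>
      exfalso
      have hd : d ∈ s₂ := by simp [hs₂]
      have hd2 : (d : ℕ) ≤ 2 := by
        rcases (by simpa using h₂.subset hd : d = 1 ∨ d = 2) with rfl | rfl <;> decide
      have hs₁ : ∀ a ∈ s₁, (a : ℕ) ≤ 2 := fun a ha =>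
        (PNat.coe_le_coe _ _ |>.2 ((List.pairwise_append.1 hsp).2.2 a ha d hd)).trans hd2
      have h₃ := small_sublist (k := 2) h₁
      rw [small_eq_self hs₁] at h₃
      have h₄ := h₃.append h₂
      have h₅ := h₄.length_le
      have h₆ := h₄.eq_of_length (by simp [h_len] at h₅ hr ⊢; omega)
      rw [h₆] at hsp
      rcases hsmall with h | h <;> rw [h] at hsp <;> exact absurd hsp (by decide)
  have hone : ∀ r, HasChain (· ≤ ·) w r → HasChain (· ≤ ·) ([1, 2] ++ w) (r + 1) := by
    rintro r ⟨t, ht, hp, rfl⟩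
    exact ⟨1 :: t, (ht.cons 2).cons_cons 1, by simpa using hp, rfl⟩
  have hno : ∀ r, 3 ≤ r → ¬ HasChain (· ≤ ·) w r := fun r hr h =>
    not_forall_hasChain h fun r' hr' h' => hstep _ (by omega) (hone r' h')
  -- Two letters of `w` above `1` in weakly increasing order could be preceded by `12`, giving a
  -- chain of length 4.
  have hdec : (w.filter fun a : ℕ+ => 1 < (a : ℕ)).Pairwise (· > ·) := by
    refine pairwise_gt_of_not_hasChain ?_
    rintro ⟨t, ht, hp, hlt⟩
    refine hno 4 (by omega) (hstep 4 le_rfl ⟨[1, 2] ++ t,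
      (List.Sublist.refl _).append (ht.trans List.filter_sublist), ?_, by simp [hlt]⟩)
    rw [List.pairwise_append]
    refine ⟨by simp, hp, fun a ha b hb => ?_⟩
    have hb : 1 < (b : ℕ) := by simpa using (List.mem_filter.1 (ht.subset hb)).2
    rw [← PNat.coe_le_coe]
    rcases (by simpa using ha : a = 1 ∨ a = 2) with rfl | rfl
    · exact b.pos
    · exact hb
  have hcount : (small 1 w).length = 1 := by
    have : small 1 w = small 1 (small 2 w) := by
      simp only [small, List.filter_filter]
      refine List.filter_congr fun a _ => ?_
      simp
      omega
    rcases hsmall with h | h <;> rw [this, h] <;> rfl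
  have hlen := length_eq_small_add 1 w
  -- The letters of `w` above `1`, followed by the `1` of the suffix, form a decreasing chain of
  -- length `|w|` in `w12`, because `w` has exactly one `1`. The matching chain in `12w` has more
  -- than two letters, so it cannot start in the prefix; it is `w` itself.
  obtain ⟨t, ht, hp, htl⟩ := (KnuthEquiv.hasChain_gt_iff hw w.length).2
    ⟨(w.filter fun a : ℕ+ => 1 < (a : ℕ)) ++ [1], List.filter_sublist.append (by simp), by
      rw [List.pairwise_append]
      refine ⟨hdec, by simp, fun a ha b hb => ?_⟩
      rw [List.mem_singleton.1 hb, gt_iff_lt, ← PNat.coe_lt_coe]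
      simpa using (List.mem_filter.1 ha).2, by simp; omega⟩
  obtain ⟨t₁, t₂, rfl, h₁, h₂⟩ := List.sublist_append_iff.1 ht
  cases t₁ with
  | nil =>
    rw [List.nil_append] at hp htl
    rwa [h₂.eq_of_length htl] at hp
  | cons a t₁ =>
    exfalso
    have ha : (a : ℕ) ≤ 2 := by
      rcases (by simpa using h₁.subset (List.mem_cons_self) : a = 1 ∨ a = 2) with rfl | rfl <;>
        decide
    have := length_le_of_pairwise_gt hp (k := 2) (by
      intro b hb
      rw [List.cons_append, List.mem_cons] at hb
      rcases hb with rfl | hb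
      · exact ha
      · have := List.rel_of_pairwise_cons hp hb
        have : (b : ℕ) < a := this
        omega)
    omega

/-! ### The polynomials -/

theorem exists_polynomial_descWord {k n : ℕ} (hk : 1 ≤ k) (hkn : k ≤ n) : ∃ p : ℚ[X],
    (∀ m : ℕ, n ≤ m → (c n m (descWord k) : ℚ) = p.eval (m : ℚ)) ∧
    p.degree = ((n - k : ℕ) : WithBot ℕ) ∧
    (k < n → p.leadingCoeff = 1 / ((n - k)! : ℚ)) ∧
    (n = k → p.leadingCoeff = (k : ℚ) ^ k) := by
  have hu : ∀ a ∈ descWord k, (a : ℕ) ≤ k := fun a ha => mem_descWord.1 ha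
  have hsm : ∀ w ∈ centralizer (descWord k), w.length = n → k ≤ (small k w).length :=
    fun w hw hl => le_length_small_of_mem_centralizer_descWord hw (hl ▸ hkn)
  rcases hkn.eq_or_lt with rfl | hlt
  · have hN : (centralizerFiber k k (descWord k) (largeLetters k (k - k))).ncard = k ^ k := by
      rw [← ncard_words k k]
      congr 1
      ext w
      constructor
      · exact fun hw => ⟨hw.2.1, fun a ha => le_of_mem_centralizerFiber le_rfl hw ha⟩
      · rintro ⟨hl, h⟩
        refine ⟨knuthEquiv_descWord_append k w h, hl, fun a => ?_⟩
        rw [mem_largeLetters]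
        exact ⟨fun h => by omega, fun h' => absurd (h a h'.1) (by omega)⟩
    obtain ⟨p, h₁, h₂, h₃⟩ := exists_polynomial le_rfl hu hsm hN (by positivity)
    exact ⟨p, h₁, h₂, fun h => absurd h (lt_irrefl _), fun _ => by simpa using h₃⟩
  · have hN : (centralizerFiber n k (descWord k) (largeLetters k (n - k))).ncard = 1 := by
      rw [centralizerFiber_eq_singleton hkn hu, Set.ncard_singleton]
      intro w hw
      obtain ⟨x, hx, hxk⟩ := exists_large_mem hlt hw
      exact pairwise_gt_of_mem_centralizer_descWord hk hw.1 hx hxk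
        (length_small_eq hkn hw (hsm w hw.1 hw.2.1))
    obtain ⟨p, h₁, h₂, h₃⟩ := exists_polynomial hkn hu hsm hN one_ne_zero
    exact ⟨p, h₁, h₂, fun _ => by simpa using h₃, fun h => absurd h hlt.ne'⟩

theorem exists_polynomial_one_two {n : ℕ} (hn : 2 ≤ n) : ∃ p : ℚ[X],
    (∀ m : ℕ, n ≤ m → (c n m [1, 2] : ℚ) = p.eval (m : ℚ)) ∧
    p.degree = ((n - 2 : ℕ) : WithBot ℕ) ∧
    (2 < n → p.leadingCoeff = 1 / ((n - 2)! : ℚ)) ∧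
    (n = 2 → p.leadingCoeff = 2) := by
  have hu : ∀ a ∈ ([1, 2] : List ℕ+), (a : ℕ) ≤ 2 := by simp
  have hsm : ∀ w ∈ centralizer [1, 2], w.length = n → 2 ≤ (small 2 w).length :=
    fun w hw hl => two_le_length_small_of_mem_centralizer hw (by omega)
  rcases hn.eq_or_lt with rfl | hlt
  · have hN : (centralizerFiber 2 2 [1, 2] (largeLetters 2 (2 - 2))).ncard = 2 := by
      have : centralizerFiber 2 2 [1, 2] (largeLetters 2 (2 - 2)) = {[1, 2], [2, 1]} := by
        ext w
        rw [Set.mem_insert_iff, Set.mem_singleton_iff]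
        constructor
        · intro hw
          rcases mem_centralizer_one_two_of_small hw.1
            (fun a ha => le_of_mem_centralizerFiber le_rfl hw ha) hw.2.1.le with h | h
          · exact absurd hw.2.1 (by simp [h])
          · exact h
        · have hlarge : ∀ a : ℕ+, a = 1 ∨ a = 2 → (a : ℕ) ≤ 2 := by
            rintro a (rfl | rfl) <;> decide
          rintro (rfl | rfl)
          · refine ⟨KnuthEquiv.refl _, rfl, fun a => ?_⟩
            simp only [mem_largeLetters, List.mem_cons, List.not_mem_nil, or_false]
            exact ⟨fun h => by omega, fun h => absurd (hlarge a (by tauto)) (by omega)⟩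
          · refine ⟨(knuthEquiv_descWord_append 2 [1, 2] hu).symm, rfl, fun a => ?_⟩
            simp only [mem_largeLetters, List.mem_cons, List.not_mem_nil, or_false]
            exact ⟨fun h => by omega, fun h => absurd (hlarge a (by tauto)) (by omega)⟩
      rw [this, Set.ncard_pair (by decide)]
    obtain ⟨p, h₁, h₂, h₃⟩ := exists_polynomial le_rfl hu hsm hN two_ne_zero
    exact ⟨p, h₁, h₂, fun h => absurd h (lt_irrefl _), fun _ => by simpa using h₃⟩
  · have hN : (centralizerFiber n 2 [1, 2] (largeLetters 2 (n - 2))).ncard = 1 := by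
      rw [centralizerFiber_eq_singleton hn hu, Set.ncard_singleton]
      intro w hw
      exact pairwise_gt_of_mem_centralizer_one_two hw.1 (hw.2.1 ▸ hlt)
        (length_small_eq hn hw (hsm w hw.1 hw.2.1))
    obtain ⟨p, h₁, h₂, h₃⟩ := exists_polynomial hn hu hsm hN one_ne_zero
    exact ⟨p, h₁, h₂, fun _ => by simpa using h₃, fun h => absurd h hlt.ne'⟩

end KnuthCentralizer

theorem mainTheorem11 :
    (∀ n : ℕ, 1 ≤ n → ∃ p : ℚ[X],
      (∀ m : ℕ, n ≤ m → (KnuthCentralizer.c n m [1] : ℚ) = p.eval (m : ℚ)) ∧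
      p.degree = ((n - 1 : ℕ) : WithBot ℕ) ∧
      p.leadingCoeff = 1 / ((n - 1)! : ℚ)) ∧
    (∀ n : ℕ, 2 ≤ n → ∃ p : ℚ[X],
      (∀ m : ℕ, n ≤ m → (KnuthCentralizer.c n m [1, 2] : ℚ) = p.eval (m : ℚ)) ∧
      p.degree = ((n - 2 : ℕ) : WithBot ℕ) ∧
      (2 < n → p.leadingCoeff = 1 / ((n - 2)! : ℚ)) ∧
      (n = 2 → p.leadingCoeff = 2)) ∧
    (∀ k n : ℕ, 1 ≤ k → k ≤ n → ∃ p : ℚ[X],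
      (∀ m : ℕ, n ≤ m →
        (KnuthCentralizer.c n m (KnuthCentralizer.descWord k) : ℚ) = p.eval (m : ℚ)) ∧
      p.degree = ((n - k : ℕ) : WithBot ℕ) ∧
      (k < n → p.leadingCoeff = 1 / ((n - k)! : ℚ)) ∧
      (n = k → p.leadingCoeff = (k : ℚ) ^ k)) := by
  refine ⟨fun n hn => ?_, fun n hn => KnuthCentralizer.exists_polynomial_one_two hn,
    fun k n hk hkn => KnuthCentralizer.exists_polynomial_descWord hk hkn⟩
  -- The word `1` is `descWord 1`; for `n = 1` the two forms of the leading coefficient agree, as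
  -- `1^1 = 1/0!`.
  obtain ⟨p, h₁, h₂, h₃, h₄⟩ := KnuthCentralizer.exists_polynomial_descWord le_rfl hn
  refine ⟨p, h₁, h₂, ?_⟩
  rcases hn.eq_or_lt with rfl | hlt
  · simpa using h₄ rfl
  · exact h₃ hlt
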